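/- For real $s>0$ let $\eta(s)=\sum_{n\ge 1}\frac{(-1)^{n-1}}{n^{s}}$ be the Dirichlet eta function, and let $\zeta$ be the Riemann zeta function. Then the following series converges and $$\zeta(3)=\frac{\pi^2}{7}\Bigl(\ln\frac{\pi}{2}-\frac12+\sum_{j=1}^{\infty}\frac{\eta(2j)}{j(j+1)}\Bigr).$$ Moreover, for every $0<x\le \pi/2$ the function $t\mapsto t\ln(\tan t)$ is integrable on $[0,x]$ and $$\frac87\int_0^x t\ln(\tan t)\,dt=\frac87\Bigl(\frac14\bigl(2\ln x-1\bigr)x^2+\sum_{j=1}^{\infty}\frac{2^{2j-1}}{\pi^{2j}\,j(j+1)}\,\eta(2j)\,x^{2j+2}\Bigr)$$ with a convergent series, and at $x=\pi/2$ the left-hand side equals $\zeta(3)$: $$\zeta(3)=\frac87\int_0^{\pi/2}t\ln(\tan t)\,dt.$$ -/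

import Mathlib

open Filter Topology

/-- The Dirichlet eta function at real arguments `s > 0`: the sum
`∑_{n ≥ 1} (-1) ^ (n - 1) / n ^ s`, as the limit of its partial sums, since the convergence is
only conditional when `s ≤ 1`. -/
noncomputable def dirichletEta (s : ℝ) : ℝ :=
  limUnder atTop (fun N : ℕ => ∑ n ∈ Finset.range N, (-1 : ℝ) ^ n / ((n : ℝ) + 1) ^ s)

/-- The defining series does converge to `dirichletEta s` for every `s > 0`. -/
theorem tendsto_dirichletEta {s : ℝ} (hs : 0 < s) :
    Tendsto (fun N : ℕ => ∑ n ∈ Finset.range N, (-1 : ℝ) ^ n / ((n : ℝ) + 1) ^ s) atTop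
      (𝓝 (dirichletEta s)) := by
  have hanti : Antitone (fun n : ℕ => (((n : ℝ) + 1) ^ s)⁻¹) := by
    intro m n hmn
    have h : (m : ℝ) ≤ n := by exact_mod_cast hmn
    have hm : (0 : ℝ) < (m : ℝ) + 1 := by positivity
    exact inv_anti₀ (Real.rpow_pos_of_pos hm s)
      (Real.rpow_le_rpow hm.le (by linarith) hs.le)
  have hlim : Tendsto (fun n : ℕ => (((n : ℝ) + 1) ^ s)⁻¹) atTop (𝓝 0) :=
    ((tendsto_rpow_atTop hs).comp
      (tendsto_atTop_add_const_right _ 1 tendsto_natCast_atTop_atTop)).inv_tendsto_atTop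
  obtain ⟨l, hl⟩ := hanti.tendsto_alternating_series_of_tendsto_zero hlim
  exact tendsto_nhds_limUnder ⟨l, by simpa only [div_eq_mul_inv] using hl⟩

/-!
Euler's product for the sine gives `-log (sinc t) = ∑ ζ(2j) / j * (t / π) ^ (2j)`. Since
`tan t / t = sinc t ^ 2 / sinc (2t)`, this turns into
`log (tan t / t) = ∑ η(2j) / j * (2t / π) ^ (2j)`, whose terms are nonnegative, so that it can be
multiplied by `t` and integrated termwise.

For `ζ(3)`, multiply the uniformly convergent cosine series
`t ^ 2 - π t + π ^ 2 / 6 = ∑ cos (2nt) / n ^ 2` by `log (tan t)` and integrate over `[0, π / 2]`.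
On the right, integration by parts reduces the Fourier coefficients of `log (tan t)` to integrals of
the Dirichlet kernel `sin (2nt) / sin (2t)`, a Chebyshev polynomial in `cos (2t)`; they vanish for
even `n` and equal `-π / (2n)` for odd `n`. On the left, `log (tan t)` is odd about `π / 4`, so it
is orthogonal to `t ^ 2 - π t / 2 + π ^ 2 / 6` and only `-π t / 2` survives. Hence
`∫ t log (tan t) = ∑ 1 / (2n + 1) ^ 3 = 7 / 8 * ζ(3)`.
-/

section

open MeasureTheory Polynomial.Chebyshev Real

/-- The Riemann zeta function at real arguments `s > 1`, as a real number. The sum runs over `ℕ+`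
to match the indexing of the series of the main theorem. -/
noncomputable def realZeta (s : ℝ) : ℝ :=
  ∑' n : ℕ+, 1 / (n : ℝ) ^ s

theorem hasSum_realZeta {s : ℝ} (hs : 1 < s) :
    HasSum (fun n : ℕ+ => 1 / (n : ℝ) ^ s) (realZeta s) :=
  ((Real.summable_one_div_nat_rpow.2 hs).comp_injective PNat.coe_injective).hasSum

theorem hasSum_one_div_nat_add_one_rpow {s : ℝ} (hs : 1 < s) :
    HasSum (fun n : ℕ => 1 / ((n : ℝ) + 1) ^ s) (realZeta s) := by
  simpa only [Nat.cast_add, Nat.cast_one] using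
    (hasSum_pnat_iff_hasSum_succ (f := fun n : ℕ => 1 / (n : ℝ) ^ s)).1 (hasSum_realZeta hs)

theorem ofReal_realZeta {s : ℝ} (hs : 1 < s) : (realZeta s : ℂ) = riemannZeta s := by
  rw [zeta_eq_tsum_one_div_nat_add_one_cpow (by simpa using hs),
    ← (hasSum_one_div_nat_add_one_rpow hs).tsum_eq, Complex.ofReal_tsum]
  congr 1 with n
  push_cast [Complex.ofReal_cpow (by positivity : (0 : ℝ) ≤ n + 1)]
  rfl

theorem hasSum_one_div_even_rpow {s : ℝ} (hs : 1 < s) :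
    HasSum (fun n : ℕ => 1 / (2 * (n : ℝ) + 2) ^ s) (2 ^ (-s) * realZeta s) := by
  refine ((hasSum_one_div_nat_add_one_rpow hs).mul_left (2 ^ (-s))).congr_fun fun n => ?_
  rw [show 2 * (n : ℝ) + 2 = 2 * (n + 1) by ring, mul_rpow zero_le_two (by positivity),
    rpow_neg zero_le_two, one_div, one_div, mul_inv]

theorem hasSum_one_div_odd_rpow {s : ℝ} (hs : 1 < s) :
    HasSum (fun n : ℕ => 1 / (2 * (n : ℝ) + 1) ^ s) ((1 - 2 ^ (-s)) * realZeta s) := by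
  have hall := hasSum_one_div_nat_add_one_rpow hs
  have hodd : HasSum (fun n : ℕ => 1 / (2 * (n : ℝ) + 1) ^ s)
      (∑' n : ℕ, 1 / (2 * (n : ℝ) + 1) ^ s) := by
    simpa only [Function.comp_def, Nat.cast_mul, Nat.cast_ofNat] using
      (hall.summable.comp_injective (mul_right_injective₀ (two_ne_zero' ℕ))).hasSum
  have hsplit : HasSum (fun n : ℕ => 1 / ((n : ℝ) + 1) ^ s)
      ((∑' n : ℕ, 1 / (2 * (n : ℝ) + 1) ^ s) + 2 ^ (-s) * realZeta s) := by
    refine HasSum.even_add_odd (hodd.congr_fun fun n => ?_)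
      ((hasSum_one_div_even_rpow hs).congr_fun fun n => ?_)
    · push_cast
      rfl
    · push_cast
      ring_nf
  convert hodd using 1
  linear_combination hall.unique hsplit

theorem dirichletEta_eq_mul_realZeta {s : ℝ} (hs : 1 < s) :
    dirichletEta s = (1 - 2 * 2 ^ (-s)) * realZeta s := by
  have hsum : HasSum (fun n : ℕ => (-1 : ℝ) ^ n / ((n : ℝ) + 1) ^ s)
      ((1 - 2 ^ (-s)) * realZeta s + -(2 ^ (-s) * realZeta s)) := by
    refine HasSum.even_add_odd ((hasSum_one_div_odd_rpow hs).congr_fun fun n => ?_)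
      ((hasSum_one_div_even_rpow hs).neg.congr_fun fun n => ?_)
    · simp
    · rw [pow_succ, pow_mul, neg_one_sq, one_pow]
      push_cast
      ring_nf
  rw [tendsto_nhds_unique (tendsto_dirichletEta (zero_lt_one.trans hs)) hsum.tendsto_sum_nat]
  ring

theorem dirichletEta_nonneg {s : ℝ} (hs : 0 < s) : 0 ≤ dirichletEta s := by
  have hanti : Antitone fun n : ℕ => 1 / ((n : ℝ) + 1) ^ s := fun m n hmn => by
    dsimp only
    gcongr
  simpa using hanti.alternating_series_le_tendsto
    (by simpa only [mul_one_div] using tendsto_dirichletEta hs) 0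

theorem hasSum_comm_of_nonneg {α β : Type*} {f : α → β → ℝ} {g : α → ℝ} {h : β → ℝ} {a : ℝ}
    (hf : ∀ i j, 0 ≤ f i j) (hg : ∀ i, HasSum (f i) (g i)) (ha : HasSum g a)
    (hh : ∀ j, HasSum (fun i => f i j) (h j)) : HasSum h a := by
  have hsummable : Summable (Function.uncurry f) := by
    refine (summable_prod_of_nonneg fun p => hf p.1 p.2).2 ⟨fun i => (hg i).summable, ?_⟩
    simpa only [Function.uncurry_apply_pair, (hg _).tsum_eq] using ha.summable
  have hprod : HasSum (Function.uncurry f) a := by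
    rw [ha.unique (hsummable.hasSum.prod_fiberwise hg)]
    exact hsummable.hasSum
  exact ((Equiv.prodComm β α).hasSum_iff.2 hprod).prod_fiberwise hh

theorem sinc_pos_of_abs_lt_pi {t : ℝ} (ht : |t| < π) : 0 < sinc t := by
  rcases eq_or_ne t 0 with rfl | h0
  · simp
  have hsinc : sinc t = sin |t| / |t| := by
    rcases abs_choice t with h | h <;> rw [h] <;> simp [sinc_of_ne_zero h0]
  rw [hsinc]
  exact div_pos (sin_pos_of_pos_of_lt_pi (abs_pos.2 h0) ht) (abs_pos.2 h0)

theorem tendsto_prod_one_sub_div_sq (y : ℝ) :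
    Tendsto (fun n : ℕ => ∏ j ∈ Finset.range n, (1 - y ^ 2 / ((j : ℝ) + 1) ^ 2)) atTop
      (𝓝 (sinc (π * y))) := by
  rcases eq_or_ne y 0 with rfl | hy
  · simp
  have hpy : π * y ≠ 0 := mul_ne_zero pi_ne_zero hy
  rw [sinc_of_ne_zero hpy]
  simpa only [mul_div_cancel_left₀ _ hpy] using (tendsto_euler_sin_prod y).div_const (π * y)

theorem sq_div_sq_lt_one {y : ℝ} (hy : |y| < 1) (n : ℕ+) : y ^ 2 / (n : ℝ) ^ 2 < 1 := by
  have hn : (1 : ℝ) ≤ n := Nat.one_le_cast.2 n.pos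
  rw [div_lt_one (by positivity), sq_lt_sq, abs_of_pos (zero_lt_one.trans_le hn)]
  exact hy.trans_le hn

theorem hasSum_neg_log_one_sub_div_sq {y : ℝ} (hy : |y| < 1) :
    HasSum (fun n : ℕ+ => -log (1 - y ^ 2 / (n : ℝ) ^ 2)) (-log (sinc (π * y))) := by
  have hpos (n : ℕ) : 0 < 1 - y ^ 2 / ((n : ℝ) + 1) ^ 2 := by
    simpa using sq_div_sq_lt_one hy n.succPNat
  have hsinc : 0 < sinc (π * y) :=
    sinc_pos_of_abs_lt_pi (by rw [abs_mul, abs_of_pos pi_pos]; nlinarith [pi_pos])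
  rw [hasSum_pnat_iff_hasSum_succ (f := fun n : ℕ => -log (1 - y ^ 2 / (n : ℝ) ^ 2)),
    hasSum_iff_tendsto_nat_of_nonneg]
  · refine ((tendsto_prod_one_sub_div_sq y).log hsinc.ne').neg.congr fun n => ?_
    rw [log_prod fun j _ => (hpos j).ne', Finset.sum_neg_distrib]
    push_cast
    rfl
  · intro n
    push_cast
    exact neg_nonneg.2 (log_nonpos (hpos n).le (sub_le_self 1 (by positivity)))

theorem hasSum_pnat_pow_div_log_of_abs_lt_one {x : ℝ} (hx : |x| < 1) :
    HasSum (fun j : ℕ+ => x ^ (j : ℕ) / (j : ℝ)) (-log (1 - x)) := by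
  rw [hasSum_pnat_iff_hasSum_succ (f := fun j : ℕ => x ^ j / (j : ℝ))]
  simpa only [Nat.cast_add, Nat.cast_one] using hasSum_pow_div_log_of_abs_lt_one hx

theorem hasSum_neg_log_sinc {t : ℝ} (ht : |t| < π) :
    HasSum (fun j : ℕ+ => realZeta (2 * (j : ℝ)) / (j : ℝ) * (t / π) ^ (2 * (j : ℕ)))
      (-log (sinc t)) := by
  have hy : |t / π| < 1 := by rwa [abs_div, abs_of_pos pi_pos, div_lt_one pi_pos]
  have hlog := hasSum_neg_log_one_sub_div_sq hy
  rw [mul_div_cancel₀ t pi_ne_zero] at hlog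
  refine hasSum_comm_of_nonneg
    (f := fun n j : ℕ+ => ((t / π) ^ 2 / (n : ℝ) ^ 2) ^ (j : ℕ) / (j : ℝ))
    (fun n j => by positivity) (fun n => ?_) hlog (fun j => ?_)
  · apply hasSum_pnat_pow_div_log_of_abs_lt_one
    rw [abs_of_nonneg (by positivity)]
    exact sq_div_sq_lt_one hy n
  · have hj : (1 : ℝ) ≤ j := Nat.one_le_cast.2 j.pos
    have hzeta := (hasSum_realZeta (s := 2 * (j : ℝ)) (by linarith)).mul_right
      ((t / π) ^ (2 * (j : ℕ)) / (j : ℝ))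
    rw [div_mul_eq_mul_div, mul_div_assoc]
    refine hzeta.congr_fun fun n => ?_
    rw [div_pow, ← pow_mul, ← pow_mul, ← rpow_natCast (n : ℝ)]
    push_cast
    ring

theorem tan_div_self_eq_sinc_sq_div_sinc_two_mul {t : ℝ} (ht : t ≠ 0) :
    tan t / t = sinc t ^ 2 / sinc (2 * t) := by
  rw [tan_eq_sin_div_cos, sinc_of_ne_zero ht, sinc_of_ne_zero (by simpa using ht), sin_two_mul]
  field_simp

theorem hasSum_log_tan_div_self {t : ℝ} (h0 : t ≠ 0) (ht : |t| < π / 2) :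
    HasSum (fun j : ℕ+ => dirichletEta (2 * (j : ℝ)) / (j : ℝ) * (2 * t / π) ^ (2 * (j : ℕ)))
      (log (tan t / t)) := by
  have ht₁ : |t| < π := ht.trans (half_lt_self pi_pos)
  have ht₂ : |2 * t| < π := by rw [abs_mul, abs_two]; linarith
  have hlog : log (tan t / t) = -log (sinc (2 * t)) - 2 * -log (sinc t) := by
    rw [tan_div_self_eq_sinc_sq_div_sinc_two_mul h0,
      log_div (pow_ne_zero 2 (sinc_pos_of_abs_lt_pi ht₁).ne') (sinc_pos_of_abs_lt_pi ht₂).ne',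
      log_pow]
    push_cast
    ring
  rw [hlog]
  refine ((hasSum_neg_log_sinc ht₂).sub ((hasSum_neg_log_sinc ht₁).mul_left 2)).congr_fun
    fun j => ?_
  have hj : (1 : ℝ) ≤ j := Nat.one_le_cast.2 j.pos
  have htwo : (2 : ℝ) ^ (-(2 * (j : ℝ))) = (2 ^ (2 * (j : ℕ)))⁻¹ := by
    rw [rpow_neg zero_le_two, ← rpow_natCast]
    push_cast
    rfl
  rw [dirichletEta_eq_mul_realZeta (by linarith), htwo, mul_div_assoc 2 t, mul_pow]
  field_simp

theorem hasSum_integral_of_nonneg {α ι : Type*} [Countable ι] [MeasurableSpace α] {μ : Measure α}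
    {F : ι → α → ℝ} {f : α → ℝ} (hF : ∀ i, AEStronglyMeasurable (F i) μ)
    (hF_nonneg : ∀ i, 0 ≤ᵐ[μ] F i) (hf : Integrable f μ)
    (hsum : ∀ᵐ a ∂μ, HasSum (fun i => F i a) (f a)) :
    HasSum (fun i => ∫ a, F i a ∂μ) (∫ a, f a ∂μ) :=
  hasSum_integral_of_dominated_convergence F hF
    (fun i => (hF_nonneg i).mono fun _ ha => (norm_of_nonneg ha).le)
    (hsum.mono fun _ ha => ha.summable)
    (hf.congr (hsum.mono fun _ ha => ha.tsum_eq.symm)) hsum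

theorem hasSum_integral_mul_of_norm_le {α ι : Type*} [Countable ι] [MeasurableSpace α]
    {μ : Measure α} {F : ι → α → ℝ} {f g : α → ℝ} {u : ι → ℝ}
    (hF : ∀ i, AEStronglyMeasurable (F i) μ) (hFu : ∀ i, ∀ᵐ a ∂μ, ‖F i a‖ ≤ u i)
    (hu : Summable u) (hg : Integrable g μ) (hsum : ∀ᵐ a ∂μ, HasSum (fun i => F i a) (f a)) :
    HasSum (fun i => ∫ a, F i a * g a ∂μ) (∫ a, f a * g a ∂μ) := by
  refine hasSum_integral_of_dominated_convergence (fun i a => u i * ‖g a‖)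
    (fun i => (hF i).mul hg.aestronglyMeasurable) (fun i => (hFu i).mono fun a ha => ?_)
    (ae_of_all _ fun a => hu.mul_right _) ?_ (hsum.mono fun a ha => ha.mul_right _)
  · rw [norm_mul]
    gcongr
  · simpa only [tsum_mul_right] using hg.norm.const_mul _

theorem intervalIntegrable_log_tan (a b : ℝ) :
    IntervalIntegrable (fun t => log (tan t)) volume a b := by
  simp only [tan_eq_sin_div_cos]
  exact (analyticOnNhd_sin.meromorphicOn.div analyticOnNhd_cos.meromorphicOn).intervalIntegrable_log

theorem intervalIntegrable_mul_log_tan (a b : ℝ) :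
    IntervalIntegrable (fun t => t * log (tan t)) volume a b :=
  (intervalIntegrable_log_tan a b).continuousOn_mul continuousOn_id

theorem integral_mul_log (a b : ℝ) :
    ∫ t in a..b, t * log t = b ^ 2 / 4 * (2 * log b - 1) - a ^ 2 / 4 * (2 * log a - 1) := by
  have hcont : Continuous fun t : ℝ => t ^ 2 / 4 * (2 * log t - 1) := by
    have : Continuous fun t : ℝ => t / 2 * (t * log t) - t ^ 2 / 4 := by fun_prop
    convert this using 2
    ring
  refine integral_eq_of_hasDerivAt_off_countable _ _ (Set.countable_singleton 0)
    hcont.continuousOn (fun t ht => ?_) (continuous_mul_log.intervalIntegrable a b)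
  have ht₀ : t ≠ 0 := ht.2
  refine (((hasDerivAt_pow 2 t).div_const 4).mul
    (((hasDerivAt_log ht₀).const_mul 2).sub_const 1)).congr_deriv ?_
  push_cast
  field_simp
  ring

theorem hasSum_mul_log_tan_sub_mul_log {t : ℝ} (ht : t ∈ Set.Ioo 0 (π / 2)) :
    HasSum (fun j : ℕ+ => dirichletEta (2 * (j : ℝ)) / (j : ℝ) * (2 / π) ^ (2 * (j : ℕ)) *
      t ^ (2 * (j : ℕ) + 1)) (t * log (tan t) - t * log t) := by
  have hlog := (hasSum_log_tan_div_self ht.1.ne' (by rw [abs_of_pos ht.1]; exact ht.2)).mul_left t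
  rw [log_div (tan_pos_of_pos_of_lt_pi_div_two ht.1 ht.2).ne' ht.1.ne', mul_sub] at hlog
  refine hlog.congr_fun fun j => ?_
  rw [mul_div_right_comm, mul_pow]
  ring

theorem hasSum_integral_mul_log_tan {x : ℝ} (hx : x ∈ Set.Icc 0 (π / 2)) :
    HasSum (fun j : ℕ+ =>
      2 ^ (2 * (j : ℕ) - 1) / (π ^ (2 * (j : ℕ)) * (j : ℝ) * ((j : ℝ) + 1)) *
        dirichletEta (2 * (j : ℝ)) * x ^ (2 * (j : ℕ) + 2))
      ((∫ t in (0 : ℝ)..x, t * log (tan t)) - 1 / 4 * (2 * log x - 1) * x ^ 2) := by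
  have hmul_log := continuous_mul_log.intervalIntegrable (μ := volume) 0 x
  have hint := (intervalIntegrable_mul_log_tan 0 x).sub hmul_log
  -- The open interval avoids `t = π / 2`, where `tan t` has the junk value `0`.
  have hsum := hasSum_integral_of_nonneg (μ := volume.restrict (Set.Ioo 0 x))
    (F := fun (j : ℕ+) t => dirichletEta (2 * (j : ℝ)) / (j : ℝ) * (2 / π) ^ (2 * (j : ℕ)) *
      t ^ (2 * (j : ℕ) + 1)) (f := fun t => t * log (tan t) - t * log t)
    (fun j => (by fun_prop : Continuous _).aestronglyMeasurable)
    (fun j => (ae_restrict_mem measurableSet_Ioo).mono fun t ht => by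
      have := dirichletEta_nonneg (s := 2 * j) (by positivity)
      have := ht.1
      dsimp only [Pi.zero_apply]
      positivity)
    ((intervalIntegrable_iff_integrableOn_Ioo_of_le hx.1).1 hint)
    ((ae_restrict_mem measurableSet_Ioo).mono fun t ht =>
      hasSum_mul_log_tan_sub_mul_log ⟨ht.1, ht.2.trans_le hx.2⟩)
  simp only [← integral_Ioc_eq_integral_Ioo, ← intervalIntegral.integral_of_le hx.1,
    intervalIntegral.integral_sub (intervalIntegrable_mul_log_tan 0 x) hmul_log,
    integral_mul_log, intervalIntegral.integral_const_mul, integral_pow] at hsum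
  convert hsum using 1
  · ext j
    have htwo : (2 : ℝ) ^ (2 * (j : ℕ)) = 2 * 2 ^ (2 * (j : ℕ) - 1) :=
      (mul_pow_sub_one (by simp) 2).symm
    rw [div_pow, htwo]
    push_cast
    field_simp
    ring
  · ring

theorem hasSum_dirichletEta_div_mul_add_one :
    HasSum (fun j : ℕ+ => dirichletEta (2 * (j : ℝ)) / ((j : ℝ) * ((j : ℝ) + 1)))
      (8 / π ^ 2 * (∫ t in (0 : ℝ)..(π / 2), t * log (tan t)) - log (π / 2) + 1 / 2) := by
  have hval : 8 / π ^ 2 * (∫ t in (0 : ℝ)..(π / 2), t * log (tan t)) - log (π / 2) + 1 / 2 =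
      8 / π ^ 2 * ((∫ t in (0 : ℝ)..(π / 2), t * log (tan t)) -
        1 / 4 * (2 * log (π / 2) - 1) * (π / 2) ^ 2) := by
    field_simp
    ring
  rw [hval]
  refine ((hasSum_integral_mul_log_tan ⟨pi_div_two_pos.le, le_rfl⟩).mul_left (8 / π ^ 2)).congr_fun
    fun j => ?_
  have htwo : (2 : ℝ) ^ (2 * (j : ℕ)) = 2 * 2 ^ (2 * (j : ℕ) - 1) :=
    (mul_pow_sub_one (by simp) 2).symm
  rw [div_pow, pow_add, pow_add, htwo]
  field_simp
  ring

/-- At the zeros of `sin (2 * t)` the limit `0` agrees with the junk values of `log` and `tan`. -/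
theorem continuous_sin_two_mul_mul_log_tan : Continuous fun t => sin (2 * t) * log (tan t) := by
  have hcont : Continuous fun t => 2 * cos t * (sin t * log (sin t)) -
      2 * sin t * (cos t * log (cos t)) := by
    fun_prop
  refine hcont.congr fun t => ?_
  rw [tan_eq_sin_div_cos, sin_two_mul]
  rcases eq_or_ne (sin t) 0 with hs | hs
  · simp [hs]
  rcases eq_or_ne (cos t) 0 with hc | hc
  · simp [hc]
  rw [log_div hs hc]
  ring

theorem hasDerivAt_log_tan {t : ℝ} (ht : sin (2 * t) ≠ 0) :
    HasDerivAt (fun t => log (tan t)) (2 / sin (2 * t)) t := by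
  have hne : 2 * sin t * cos t ≠ 0 := by rwa [← sin_two_mul]
  have hs : sin t ≠ 0 := right_ne_zero_of_mul (left_ne_zero_of_mul hne)
  have hc : cos t ≠ 0 := right_ne_zero_of_mul hne
  refine ((hasDerivAt_tan hc).log (by rw [tan_eq_sin_div_cos]; positivity)).congr_deriv ?_
  rw [tan_eq_sin_div_cos, sin_two_mul]
  field_simp

theorem integral_cos_mul_two_mul {n : ℤ} (hn : n ≠ 0) :
    ∫ t in (0 : ℝ)..(π / 2), cos (n * (2 * t)) = 0 := by
  have hn' : (n : ℝ) * 2 ≠ 0 := by positivity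
  simp only [← mul_assoc]
  rw [intervalIntegral.integral_comp_mul_left cos hn', integral_cos,
    show (n : ℝ) * 2 * (π / 2) = n * π by ring, sin_int_mul_pi]
  simp

theorem integral_eval_U_cos_two_mul (n : ℕ) :
    ∫ t in (0 : ℝ)..(π / 2), (U ℝ (n - 1)).eval (cos (2 * t)) = if Odd n then π / 2 else 0 := by
  induction n using Nat.twoStepInduction with
  | zero => simp
  | one => simp
  | more n ih _ =>
    have hU : U ℝ ((n + 2 : ℕ) - 1) = U ℝ (n - 1) + 2 * T ℝ (n + 1) := by
      have := two_mul_T_eq_U_sub_U ℝ ((n : ℤ) - 1)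
      rw [show (n : ℤ) - 1 + 2 = n + 1 by ring] at this
      rw [this]
      push_cast
      ring_nf
    have hT : ∫ t in (0 : ℝ)..(π / 2), (2 * T ℝ (n + 1)).eval (cos (2 * t)) = 0 := by
      simp only [Polynomial.eval_mul, Polynomial.eval_ofNat, T_real_cos,
        intervalIntegral.integral_const_mul]
      rw [integral_cos_mul_two_mul (by positivity), mul_zero]
    simp only [hU, Polynomial.eval_add]
    rw [intervalIntegral.integral_add, ih, hT, add_zero]
    · simp [Nat.odd_add]
    all_goals exact Continuous.intervalIntegrable (by fun_prop) _ _

theorem eval_U_sub_one_cos_mul_sin (n : ℤ) (θ : ℝ) :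
    (U ℝ (n - 1)).eval (cos θ) * sin θ = sin (n * θ) := by
  simp [U_real_cos]

theorem continuous_sin_int_mul_mul_log_tan (n : ℤ) :
    Continuous fun t => sin (n * (2 * t)) * log (tan t) := by
  simp only [← eval_U_sub_one_cos_mul_sin, mul_assoc]
  have := continuous_sin_two_mul_mul_log_tan
  fun_prop

theorem hasDerivAt_sin_int_mul_mul_log_tan (n : ℤ) {t : ℝ} (ht : sin (2 * t) ≠ 0) :
    HasDerivAt (fun t => sin (n * (2 * t)) * log (tan t))
      (2 * n * (cos (n * (2 * t)) * log (tan t)) + 2 * (U ℝ (n - 1)).eval (cos (2 * t))) t := by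
  refine ((((hasDerivAt_id t).const_mul 2).const_mul (n : ℝ)).sin.mul
    (hasDerivAt_log_tan ht)).congr_deriv ?_
  rw [← eval_U_sub_one_cos_mul_sin]
  simp only [id]
  field_simp

theorem integral_cos_mul_log_tan {n : ℕ} (hn : n ≠ 0) :
    ∫ t in (0 : ℝ)..(π / 2), cos (n * (2 * t)) * log (tan t) =
      if Odd n then -(π / 2) / n else 0 := by
  have hcos : IntervalIntegrable (fun t => 2 * n * (cos (n * (2 * t)) * log (tan t)))
      volume 0 (π / 2) :=
    ((intervalIntegrable_log_tan 0 _).continuousOn_mul (by fun_prop)).const_mul _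
  have hU : IntervalIntegrable (fun t => 2 * (U ℝ (n - 1)).eval (cos (2 * t))) volume 0 (π / 2) :=
    Continuous.intervalIntegrable (by fun_prop) _ _
  have hint := intervalIntegral.integral_eq_sub_of_hasDerivAt_of_le pi_div_two_pos.le
    (continuous_sin_int_mul_mul_log_tan n).continuousOn
    (fun t ht => hasDerivAt_sin_int_mul_mul_log_tan n (sin_pos_of_pos_of_lt_pi
      (by linarith [ht.1]) (by linarith [ht.2])).ne') (hcos.add hU)
  simp only [Int.cast_natCast, intervalIntegral.integral_add hcos hU,
    intervalIntegral.integral_const_mul, integral_eval_U_cos_two_mul, tan_pi_div_two, tan_zero,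
    log_zero, mul_zero, sub_zero] at hint
  rw [eq_div_of_mul_eq (by positivity) ((mul_comm _ _).trans (eq_neg_of_add_eq_zero_left hint))]
  split_ifs
  · field_simp
  · simp

theorem hasSum_cos_div_sq {t : ℝ} (ht : t ∈ Set.Icc 0 π) :
    HasSum (fun n : ℕ => 1 / (n : ℝ) ^ 2 * cos (n * (2 * t))) (t ^ 2 - π * t + π ^ 2 / 6) := by
  have hsum := hasSum_one_div_nat_pow_mul_cos one_ne_zero (x := t / π)
    ⟨div_nonneg ht.1 pi_pos.le, (div_le_one pi_pos).2 ht.2⟩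
  have hval : (-1) ^ (1 + 1) * (2 * π) ^ (2 * 1) / 2 / (2 * 1).factorial * bernoulliFun (2 * 1)
      (t / π) = t ^ 2 - π * t + π ^ 2 / 6 := by
    rw [mul_one, bernoulliFun_two]
    rw [Nat.factorial_two]
    push_cast
    field_simp
  rw [← hval]
  refine hsum.congr_fun fun n => ?_
  rw [mul_one]
  congr 2
  field_simp

theorem integral_mul_log_tan_eq_zero_of_symm {q : ℝ → ℝ} (hq : ∀ t, q (π / 2 - t) = q t) :
    ∫ t in (0 : ℝ)..(π / 2), q t * log (tan t) = 0 := by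
  have hreflect := intervalIntegral.integral_comp_sub_left (a := 0) (b := π / 2)
    (fun t => q t * log (tan t)) (π / 2)
  simp only [hq, tan_pi_div_two_sub, log_inv, mul_neg, sub_self, sub_zero,
    intervalIntegral.integral_neg] at hreflect
  linarith

theorem integral_quadratic_mul_log_tan :
    ∫ t in (0 : ℝ)..(π / 2), (t ^ 2 - π * t + π ^ 2 / 6) * log (tan t) =
      -(π / 2) * ∫ t in (0 : ℝ)..(π / 2), t * log (tan t) := by
  have hsymm : ∫ t in (0 : ℝ)..(π / 2), (t ^ 2 - π / 2 * t + π ^ 2 / 6) * log (tan t) = 0 :=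
    integral_mul_log_tan_eq_zero_of_symm fun t => by ring
  rw [← intervalIntegral.integral_const_mul, ← sub_eq_zero, ← intervalIntegral.integral_sub]
  · convert hsymm using 3
    ring
  · exact (intervalIntegrable_log_tan 0 _).continuousOn_mul (by fun_prop)
  · exact (intervalIntegrable_mul_log_tan 0 _).const_mul _

theorem hasSum_integral_cos_mul_log_tan_div_sq :
    HasSum (fun n : ℕ => 1 / (n : ℝ) ^ 2 * ∫ t in (0 : ℝ)..(π / 2), cos (n * (2 * t)) * log (tan t))
      (∫ t in (0 : ℝ)..(π / 2), (t ^ 2 - π * t + π ^ 2 / 6) * log (tan t)) := by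
  have hsum := hasSum_integral_mul_of_norm_le (μ := volume.restrict (Set.Ioc 0 (π / 2)))
    (F := fun (n : ℕ) t => 1 / (n : ℝ) ^ 2 * cos (n * (2 * t))) (u := fun n => 1 / (n : ℝ) ^ 2)
    (f := fun t => t ^ 2 - π * t + π ^ 2 / 6)
    (fun n => (by fun_prop : Continuous _).aestronglyMeasurable)
    (fun n => ae_of_all _ fun t => by
      rw [norm_mul, norm_of_nonneg (by positivity)]
      exact mul_le_of_le_one_right (by positivity) (abs_cos_le_one _))
    (summable_one_div_nat_pow.2 one_lt_two)
    ((intervalIntegrable_iff_integrableOn_Ioc_of_le pi_div_two_pos.le).1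
      (intervalIntegrable_log_tan 0 (π / 2)))
    ((ae_restrict_mem measurableSet_Ioc).mono fun t ht =>
      hasSum_cos_div_sq ⟨ht.1.le, by linarith [ht.2, pi_pos]⟩)
  simpa only [← intervalIntegral.integral_of_le pi_div_two_pos.le, mul_assoc,
    intervalIntegral.integral_const_mul] using hsum

theorem hasSum_one_div_odd_pow_three :
    HasSum (fun n : ℕ => 1 / (2 * (n : ℝ) + 1) ^ 3) (∫ t in (0 : ℝ)..(π / 2), t * log (tan t)) := by
  have hsum := hasSum_integral_cos_mul_log_tan_div_sq
  rw [integral_quadratic_mul_log_tan] at hsum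
  have hodd_injective : Function.Injective fun n : ℕ => 2 * n + 1 := fun m n h => by
    dsimp only at h
    omega
  rw [← hodd_injective.hasSum_iff] at hsum
  · have hscaled := hsum.mul_left (-(π / 2))⁻¹
    rw [inv_mul_cancel_left₀ (neg_ne_zero.2 pi_div_two_pos.ne')] at hscaled
    refine hscaled.congr_fun fun n => ?_
    rw [Function.comp_apply, integral_cos_mul_log_tan (by simp),
      if_pos (odd_two_mul_add_one n)]
    push_cast
    field_simp
  · intro n hn
    rcases eq_or_ne n 0 with rfl | hn₀
    · simp
    rw [integral_cos_mul_log_tan hn₀, if_neg, mul_zero]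
    rintro ⟨k, rfl⟩
    exact hn ⟨k, rfl⟩

theorem integral_mul_log_tan_zero_pi_div_two :
    ∫ t in (0 : ℝ)..(π / 2), t * log (tan t) = 7 / 8 * realZeta 3 := by
  have hval : (7 / 8 : ℝ) = 1 - 2 ^ (-3 : ℝ) := by norm_num [rpow_neg]
  have hodd := hasSum_one_div_odd_rpow (s := 3) (by norm_num)
  simp only [rpow_ofNat] at hodd
  rw [hval]
  exact hasSum_one_div_odd_pow_three.unique hodd

theorem riemannZeta_three_eq_integral :
    riemannZeta 3 = ((8 / 7 * ∫ t in (0 : ℝ)..(π / 2), t * log (tan t) : ℝ) : ℂ) := by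
  rw [integral_mul_log_tan_zero_pi_div_two, ← mul_assoc, show (8 / 7 * (7 / 8) : ℝ) = 1 by norm_num,
    one_mul, ofReal_realZeta (by norm_num), Complex.ofReal_ofNat]

end

theorem mainTheorem8 :
    (Summable (fun j : ℕ+ => dirichletEta (2 * (j : ℝ)) / ((j : ℝ) * ((j : ℝ) + 1))) ∧
      riemannZeta 3 =
        ((Real.pi ^ 2 / 7 * (Real.log (Real.pi / 2) - 1 / 2 +
          ∑' j : ℕ+, dirichletEta (2 * (j : ℝ)) / ((j : ℝ) * ((j : ℝ) + 1))) : ℝ) : ℂ)) ∧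
    (∀ x : ℝ, 0 < x → x ≤ Real.pi / 2 →
      IntervalIntegrable (fun t : ℝ => t * Real.log (Real.tan t)) MeasureTheory.volume 0 x ∧
      Summable (fun j : ℕ+ =>
        2 ^ (2 * (j : ℕ) - 1) / (Real.pi ^ (2 * (j : ℕ)) * (j : ℝ) * ((j : ℝ) + 1)) *
          dirichletEta (2 * (j : ℝ)) * x ^ (2 * (j : ℕ) + 2)) ∧
      8 / 7 * ∫ t in (0 : ℝ)..x, t * Real.log (Real.tan t) =
        8 / 7 * (1 / 4 * (2 * Real.log x - 1) * x ^ 2 +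
          ∑' j : ℕ+,
            2 ^ (2 * (j : ℕ) - 1) / (Real.pi ^ (2 * (j : ℕ)) * (j : ℝ) * ((j : ℝ) + 1)) *
              dirichletEta (2 * (j : ℝ)) * x ^ (2 * (j : ℕ) + 2))) ∧
    riemannZeta 3 =
      ((8 / 7 * ∫ t in (0 : ℝ)..(Real.pi / 2), t * Real.log (Real.tan t) : ℝ) : ℂ) := by
  refine ⟨⟨hasSum_dirichletEta_div_mul_add_one.summable, ?_⟩, fun x hx hx' => ?_,
    riemannZeta_three_eq_integral⟩
  · rw [riemannZeta_three_eq_integral, hasSum_dirichletEta_div_mul_add_one.tsum_eq]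
    congr 1
    field_simp
    ring
  · have hsum := hasSum_integral_mul_log_tan ⟨hx.le, hx'⟩
    refine ⟨intervalIntegrable_mul_log_tan 0 x, hsum.summable, ?_⟩
    rw [hsum.tsum_eq]
    ring
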